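/- All algebras are over $\mathbb{C}$. For a commutative Banach algebra $A$ with unit, $M(A)$ is the set of nonzero multiplicative linear functionals on $A$ with the relative weak-star topology, and $\hat a(\gamma)=\gamma(a)$ is the Gelfand transform. **Definitions.** Let $E$ be a commutative Banach algebra with unit and $X$ a nonempty compact Hausdorff space. An *$E$-valued function algebra on $X$* is a subalgebra $F\subset C(X,E)$ with a complete algebra norm of its own such that $F$ contains the constant function $1_E$, $F$ separates the points of $X$, and each evaluation map $e_x:F\to E$, $f\mapsto f(x)$, is continuous. For $E=\mathbb{C}$, $F$ is *natural* if $x\mapsto e_x$ is a bijection of $X$ onto $M(F)$. An *admissible quadruple* is a quadruple $(X,E,B,\tilde B)$ in which $B\subset C(X)$ is a natural $\mathbb{C}$-valued function algebra on $X$, $\tilde B\subset C(X,E)$ is an $E$-valued function algebra on $X$, $B\cdot E\subset\tilde B$ (that is, $x\mapsto b(x)e$ belongs to $\tilde B$ for all $b\in B$, $e\in E$), and $\lambda\circ f\in B$ for all $f\in\tilde B$, $\lambda\in M(E)$. It is *natural* if the map $X\times M(E)\to M(\tilde B)$, $(x,\psi)\mapsto\psi\circ e_x$, is bijective. A *Tomiyama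 product* of commutative Banach algebras $A$ and $B$ with unit is the completion of the algebraic tensor product $A\otimes B$ with respect to some submultiplicative norm $p$ on $A\otimes B$ with $p(a\otimes b)=\|a\|\,\|b\|$ for all $a\in A$, $b\in B$, and $p(u)\ge\sup\{|(\varphi\otimes\psi)(u)|:\varphi\in A^*,\ \psi\in B^*,\ \|\varphi\|\le1,\ \|\psi\|\le1\}$ (the injective norm of $u$) for all $u\in A\otimes B$. **Proposition.** Let $A$ and $B$ be nonzero commutative Banach algebras with unit, and let $C$ be a Tomiyama product of $A$ and $B$. Suppose that $C$ is semisimple, i.e. its Jacobson radical is $0$. Then $(M(B),A,B,C)$ is a natural admissible quadruple. Here $B$ is regarded as a subalgebra of $C(M(B))$ by the Gelfand transform, and $C$ as a subalgebra of $C(M(B),A)$ by an injective unital algebra homomorphism $\Psi:C\to C(M(B),A)$ with $\Psi(a\otimes b)(\gamma)=\gamma(b)\,a$ for all $a\in A$, $b\in B$, $\gamma\in M(B)$; both keep their own norms. In particular, it is part of the claim that the Gelfand transform of $B$ is injective and that such a $\Psi$ exists. -/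

import Mathlib

open scoped TensorProduct
open WeakDual

noncomputable section

namespace Tomiyama

/-! ### The injective tensor norm and Tomiyama products -/

section TensorNorms

variable (A B : Type*) [NormedCommRing A] [NormedAlgebra ℂ A]
  [NormedCommRing B] [NormedAlgebra ℂ B]

/-- The set of all values `|(φ ⊗ ψ)(u)|`, where `φ` and `ψ` run over the closed unit balls of the
dual spaces of `A` and `B`. -/
def injectiveValues (u : A ⊗[ℂ] B) : Set ℝ :=
  {r | ∃ (φ : A →L[ℂ] ℂ) (ψ : B →L[ℂ] ℂ), ‖φ‖ ≤ 1 ∧ ‖ψ‖ ≤ 1 ∧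
    r = ‖TensorProduct.dualDistrib ℂ A B ((φ : A →ₗ[ℂ] ℂ) ⊗ₜ[ℂ] (ψ : B →ₗ[ℂ] ℂ)) u‖}

/-- The injective tensor norm on the algebraic tensor product,
`sup {|(φ ⊗ ψ)(u)| : ‖φ‖ ≤ 1, ‖ψ‖ ≤ 1}`. -/
def injectiveNorm (u : A ⊗[ℂ] B) : ℝ := sSup (injectiveValues A B u)

/-- The supremum defining the injective norm is a supremum of a bounded set. -/
theorem injectiveValues_bddAbove (u : A ⊗[ℂ] B) : BddAbove (injectiveValues A B u) := by
  induction u with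
  | zero =>
    refine ⟨0, ?_⟩
    rintro r ⟨φ, ψ, -, -, rfl⟩
    simp
  | tmul a b =>
    refine ⟨‖a‖ * ‖b‖, ?_⟩
    rintro r ⟨φ, ψ, hφ, hψ, rfl⟩
    have h1 : ‖φ a‖ ≤ ‖a‖ := by simpa using φ.le_of_opNorm_le hφ a
    have h2 : ‖ψ b‖ ≤ ‖b‖ := by simpa using ψ.le_of_opNorm_le hψ b
    simpa using mul_le_mul h1 h2 (norm_nonneg _) (norm_nonneg _)
  | add u v hu hv =>
    obtain ⟨M, hM⟩ := hu
    obtain ⟨N, hN⟩ := hv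
    refine ⟨M + N, ?_⟩
    rintro r ⟨φ, ψ, hφ, hψ, rfl⟩
    rw [map_add]
    exact (norm_add_le _ _).trans
      (add_le_add (hM ⟨φ, ψ, hφ, hψ, rfl⟩) (hN ⟨φ, ψ, hφ, hψ, rfl⟩))

variable {A B}

/-- A submultiplicative norm `p` on `A ⊗ B` (submultiplicativity is part of `AlgebraNorm`) which
is a cross norm and is not less than the injective tensor norm. -/
structure IsTomiyamaNorm (p : AlgebraNorm ℂ (A ⊗[ℂ] B)) : Prop where
  cross : ∀ (a : A) (b : B), p (a ⊗ₜ[ℂ] b) = ‖a‖ * ‖b‖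
  injectiveNorm_le : ∀ u : A ⊗[ℂ] B, injectiveNorm A B u ≤ p u

/-- The Banach algebra `C`, together with the canonical homomorphism `ι : A ⊗ B → C`, is a
Tomiyama product of `A` and `B`: it is the completion of `A ⊗ B` with respect to some
submultiplicative cross norm `p` not less than the injective norm, that is, `C` is complete and
`ι` is an isometry from `(A ⊗ B, p)` onto a dense subalgebra of `C`. -/
def IsTomiyamaProduct {C : Type*} [NormedCommRing C] [NormedAlgebra ℂ C] [CompleteSpace C]
    (ι : A ⊗[ℂ] B →ₐ[ℂ] C) : Prop :=
  ∃ p : AlgebraNorm ℂ (A ⊗[ℂ] B), IsTomiyamaNorm p ∧ (∀ u, ‖ι u‖ = p u) ∧ DenseRange ι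

end TensorNorms

/-! ### Vector-valued function algebras and admissible quadruples -/

section FunctionAlgebras

variable {X : Type*} [TopologicalSpace X] [CompactSpace X] [T2Space X]
variable {E : Type*} [NormedCommRing E] [NormedAlgebra ℂ E] [CompleteSpace E]
variable {F : Type*} [NormedCommRing F] [NormedAlgebra ℂ F] [CompleteSpace F]

/-- The evaluation map `e_x : F → E`, `f ↦ f(x)`, of an algebra `F` that is realized by
`j : F → C(X, E)` as an algebra of continuous `E`-valued functions on `X`. -/
def evalAt (j : F →ₐ[ℂ] C(X, E)) (x : X) : F →ₐ[ℂ] E :=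
  (ContinuousMap.evalAlgHom ℂ E x).comp j

/-- `F` is an `E`-valued function algebra on `X`. A subalgebra of `C(X, E)` equipped with a
complete algebra norm of its own is given as the Banach algebra `F` with its inclusion `j` into
`C(X, E)`, an injective algebra homomorphism; the subalgebra itself is the range of `j`. -/
structure IsFunctionAlgebra (j : F →ₐ[ℂ] C(X, E)) : Prop where
  injective : Function.Injective j
  const_one_mem : ContinuousMap.const X (1 : E) ∈ j.range
  separates : ∀ x y : X, x ≠ y → ∃ f : F, j f x ≠ j f y
  continuous_eval : ∀ x : X, Continuous (evalAt j x)

/-- The associated map (Hausner's map) `β : X × M(E) → M(F)`, `(x, ψ) ↦ ψ ∘ e_x`. -/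
def hausnerMap (j : F →ₐ[ℂ] C(X, E)) (q : X × characterSpace ℂ E) : characterSpace ℂ F :=
  CharacterSpace.equivAlgHom.symm ((CharacterSpace.equivAlgHom q.2).comp (evalAt j q.1))

/-- Evaluation at `x`, as a character of an algebra of complex-valued functions on `X`. -/
def evalCharacter (j : F →ₐ[ℂ] C(X, ℂ)) (x : X) : characterSpace ℂ F :=
  CharacterSpace.equivAlgHom.symm (evalAt j x)

/-- `F` is a natural `ℂ`-valued function algebra on `X`: it is a function algebra on `X` whose
characters are exactly the evaluations at the points of `X`. -/
structure IsNaturalFunctionAlgebra (j : F →ₐ[ℂ] C(X, ℂ)) : Prop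
    extends IsFunctionAlgebra j where
  bijective_evalCharacter : Function.Bijective (evalCharacter j)

variable {B : Type*} [NormedCommRing B] [NormedAlgebra ℂ B] [CompleteSpace B]

/-- `(X, E, B, F)` is an admissible quadruple, where `B` is regarded as a subalgebra of `C(X)`
through `i` and `F` as a subalgebra of `C(X, E)` through `j`. That `X` is a compact Hausdorff
space and `E` is a commutative Banach algebra with unit is part of the context. -/
structure IsAdmissibleQuadruple (i : B →ₐ[ℂ] C(X, ℂ)) (j : F →ₐ[ℂ] C(X, E)) : Prop where
  nonempty : Nonempty X
  natural_scalar : IsNaturalFunctionAlgebra i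
  functionAlgebra : IsFunctionAlgebra j
  smul_mem : ∀ (b : B) (e : E), ∃ f : F, ∀ x : X, j f x = i b x • e
  comp_mem : ∀ (f : F) (l : characterSpace ℂ E), ∃ b : B, ∀ x : X, i b x = l (j f x)

/-- `(X, E, B, F)` is a natural admissible quadruple: it is an admissible quadruple and its
associated map `X × M(E) → M(F)` is bijective. -/
structure IsNaturalAdmissibleQuadruple (i : B →ₐ[ℂ] C(X, ℂ)) (j : F →ₐ[ℂ] C(X, E)) : Prop
    extends IsAdmissibleQuadruple i j where
  bijective_hausnerMap : Function.Bijective (hausnerMap j)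

end FunctionAlgebras

end Tomiyama

end

/-!
The slice maps of `A ⊗ B` carry the proof. For characters `γ` of `B` and `l` of `A`, the maps
`a ⊗ b ↦ γ(b) a` and `a ⊗ b ↦ l(a) b` are algebra homomorphisms to `A` and `B`. Characters have
norm at most one, so composing a slice map with a functional in the dual unit ball gives a
functional `φ ⊗ ψ` with `φ`, `ψ` in the dual unit balls; by Hahn–Banach the slice maps are
contractive for the injective norm (`norm_le_injectiveNorm`), hence for the norm of `C`, and they
extend to `C` (`exists_algHom_extension`). Letting `γ` vary, the first family assembles to one
homomorphism `A ⊗ B → C(M(B), A)`, contractive for the sup norm, whose extension is `Ψ`.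

A character `χ` of `C` restricts to characters `l` of `A` and `γ` of `B`, and `χ(c) = l(Ψ(c)(γ))`
on the dense range of `A ⊗ B`, hence everywhere (`exists_character_factorization`). This is the
surjectivity of Hausner's map; it also shows that every character of `C` vanishes on the kernel of
`Ψ`, which therefore lies in the Jacobson radical and is zero by semisimplicity. Injectivity of the
Gelfand transform of `B` follows by restricting `Ψ` to the elements `1 ⊗ b`. Finally
`x ↦ l(Ψ(c)(x))` is the Gelfand transform of the image of `c` under the extended second slice map.
-/

noncomputable section

namespace Tomiyama

/-- A character is contractive, even when the unit of the algebra has norm greater than one: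
`|γ(b)|ⁿ = |γ(bⁿ)| ≤ ‖bⁿ‖ ‖1‖` for all `n`. -/
theorem norm_character_apply_le {B : Type*} [NormedCommRing B] [NormedAlgebra ℂ B]
    [CompleteSpace B] (γ : characterSpace ℂ B) (b : B) : ‖γ b‖ ≤ ‖b‖ := by
  by_contra! hlt
  have hpos : 0 < ‖γ b‖ := (norm_nonneg b).trans_lt hlt
  have hbound (n : ℕ) : ‖γ b‖ ^ (n + 1) ≤ ‖b‖ ^ (n + 1) * ‖(1 : B)‖ := by
    rw [← norm_pow, ← map_pow]
    exact (AlgHom.norm_apply_le_self_mul_norm_one γ _).trans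
      (mul_le_mul_of_nonneg_right (norm_pow_le' b n.succ_pos) (norm_nonneg _))
  have hlim : Filter.Tendsto (fun n : ℕ => (‖b‖ / ‖γ b‖) ^ (n + 1) * ‖(1 : B)‖)
      Filter.atTop (nhds (0 * ‖(1 : B)‖)) :=
    (((tendsto_pow_atTop_nhds_zero_of_lt_one (by positivity)
      ((div_lt_one hpos).2 hlt)).comp (Filter.tendsto_add_atTop_nat 1))).mul_const _
  have hge (n : ℕ) : 1 ≤ (‖b‖ / ‖γ b‖) ^ (n + 1) * ‖(1 : B)‖ := by
    rw [div_pow, div_mul_eq_mul_div, le_div_iff₀ (by positivity), one_mul]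
    exact hbound n
  have h10 := ge_of_tendsto' hlim hge
  rw [zero_mul] at h10
  exact absurd h10 (by norm_num)

theorem norm_toCLM_character_le_one {B : Type*} [NormedCommRing B] [NormedAlgebra ℂ B]
    [CompleteSpace B] (γ : characterSpace ℂ B) : ‖CharacterSpace.toCLM γ‖ ≤ 1 :=
  ContinuousLinearMap.opNorm_le_bound _ zero_le_one fun b => by
    simpa using norm_character_apply_le γ b

section Extension

variable {R C D : Type*} [Ring R] [Algebra ℂ R] [NormedRing C] [NormedAlgebra ℂ C]
  [NormedRing D] [NormedAlgebra ℂ D] [CompleteSpace D]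

/-- A homomorphism that is dominated by the norm of a dense image extends to a continuous
homomorphism. -/
theorem exists_algHom_extension {ι : R →ₐ[ℂ] C} (hι : DenseRange ι) (T : R →ₐ[ℂ] D)
    (hT : ∀ u, ‖T u‖ ≤ ‖ι u‖) :
    ∃ Φ : C →ₐ[ℂ] D, Continuous Φ ∧ ∀ u, Φ (ι u) = T u := by
  let L : C →L[ℂ] D := T.toLinearMap.extendOfNorm ι.toLinearMap
  have hL (u : R) : L (ι u) = T u :=
    LinearMap.extendOfNorm_eq (f := T.toLinearMap) (e := ι.toLinearMap) hι
      ⟨1, fun x => by simpa using hT x⟩ u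
  refine ⟨AlgHom.ofLinearMap L.toLinearMap ?_ ?_, L.continuous, hL⟩
  · simpa using hL 1
  · intro c d
    refine hι.induction_on₂ (p := fun c d => L (c * d) = L c * L d) ?_ ?_ c d
    · exact isClosed_eq (by fun_prop) (by fun_prop)
    · intro u v
      rw [← map_mul, hL, hL, hL, map_mul]

end Extension

/-- An element of a commutative Banach algebra at which all characters vanish lies in the Jacobson
radical. -/
theorem mem_jacobson_of_character_eq_zero {C : Type*} [NormedCommRing C] [NormedAlgebra ℂ C]
    [CompleteSpace C] {c : C} (hc : ∀ χ : characterSpace ℂ C, χ c = 0) :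
    c ∈ Ring.jacobson C := by
  rw [← Ideal.jacobson_bot, Ideal.mem_jacobson_bot]
  intro d
  by_contra hd
  obtain ⟨χ, hχ⟩ := CharacterSpace.exists_apply_eq_zero hd
  simp [hc χ] at hχ

section Slices

variable {A B : Type*} [NormedCommRing A] [NormedAlgebra ℂ A]
  [NormedCommRing B] [NormedAlgebra ℂ B]

/-- By Hahn–Banach, a linear map on `A ⊗ B` whose composition with each functional of norm at most
one is some `φ ⊗ ψ` with `‖φ‖, ‖ψ‖ ≤ 1` is contractive for the injective norm. -/
theorem norm_le_injectiveNorm {D : Type*} [NormedAddCommGroup D] [NormedSpace ℂ D]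
    (T : A ⊗[ℂ] B →ₗ[ℂ] D)
    (hT : ∀ f : D →L[ℂ] ℂ, ‖f‖ ≤ 1 → ∃ (φ : A →L[ℂ] ℂ) (ψ : B →L[ℂ] ℂ), ‖φ‖ ≤ 1 ∧ ‖ψ‖ ≤ 1 ∧
      ∀ a b, f (T (a ⊗ₜ[ℂ] b)) = φ a * ψ b) (u : A ⊗[ℂ] B) :
    ‖T u‖ ≤ injectiveNorm A B u := by
  obtain ⟨f, hf, hfu⟩ := exists_dual_vector'' ℂ (T u)
  obtain ⟨φ, ψ, hφ, hψ, h⟩ := hT f hf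
  have heq : f.toLinearMap ∘ₗ T =
      TensorProduct.dualDistrib ℂ A B ((φ : A →ₗ[ℂ] ℂ) ⊗ₜ[ℂ] (ψ : B →ₗ[ℂ] ℂ)) := by
    ext a b
    simpa using h a b
  refine le_csSup (injectiveValues_bddAbove A B u) ⟨φ, ψ, hφ, hψ, ?_⟩
  rw [← heq]
  simp [hfu]

/-- The homomorphism `A ⊗ B → C(M(B), A)`, `a ⊗ b ↦ (γ ↦ γ(b) a)`; its value at `γ` is the slice
map `id ⊗ γ`. -/
def gelfandSlice (A B : Type*) [NormedCommRing A] [NormedAlgebra ℂ A]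
    [NormedCommRing B] [NormedAlgebra ℂ B] : A ⊗[ℂ] B →ₐ[ℂ] C(characterSpace ℂ B, A) :=
  Algebra.TensorProduct.productMap
    { ContinuousMap.C with commutes' := fun _ => rfl }
    (((Algebra.ofId ℂ A).compLeftContinuous ℂ (continuous_algebraMap ℂ A)).comp
      (gelfandTransform ℂ B))

@[simp]
theorem gelfandSlice_tmul (a : A) (b : B) (γ : characterSpace ℂ B) :
    gelfandSlice A B (a ⊗ₜ[ℂ] b) γ = γ b • a := by
  change a * algebraMap ℂ A (γ b) = _
  rw [mul_comm, Algebra.smul_def]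

/-- The slice map `l ⊗ id : A ⊗ B → B`, `a ⊗ b ↦ l(a) b`. -/
def leftSlice [CompleteSpace A] (B : Type*) [NormedCommRing B] [NormedAlgebra ℂ B]
    (l : characterSpace ℂ A) :
    A ⊗[ℂ] B →ₐ[ℂ] B :=
  Algebra.TensorProduct.productMap
    ((Algebra.ofId ℂ B).comp (CharacterSpace.equivAlgHom l)) (AlgHom.id ℂ B)

@[simp]
theorem leftSlice_tmul [CompleteSpace A] (l : characterSpace ℂ A) (a : A) (b : B) :
    leftSlice B l (a ⊗ₜ[ℂ] b) = l a • b := by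
  rw [Algebra.smul_def]
  rfl

theorem norm_gelfandSlice_le [CompleteSpace B] [Nontrivial B] (u : A ⊗[ℂ] B) :
    ‖gelfandSlice A B u‖ ≤ injectiveNorm A B u := by
  refine (ContinuousMap.norm_le_of_nonempty _).2 fun γ => ?_
  refine norm_le_injectiveNorm
    (((ContinuousMap.evalAlgHom ℂ A γ).comp (gelfandSlice A B)).toLinearMap) (fun f hf =>
      ⟨f, CharacterSpace.toCLM γ, hf, norm_toCLM_character_le_one γ, fun a b => ?_⟩) u
  change f (gelfandSlice A B (a ⊗ₜ[ℂ] b) γ) = f a * γ b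
  simp [mul_comm]

theorem norm_leftSlice_le [CompleteSpace A] (l : characterSpace ℂ A) (u : A ⊗[ℂ] B) :
    ‖leftSlice B l u‖ ≤ injectiveNorm A B u := by
  refine norm_le_injectiveNorm (leftSlice B l).toLinearMap (fun f hf =>
      ⟨CharacterSpace.toCLM l, f, norm_toCLM_character_le_one l, hf, fun a b => ?_⟩) u
  change f (leftSlice B l (a ⊗ₜ[ℂ] b)) = l a * f b
  simp

end Slices

section Characters

variable {A B C : Type*} [NormedCommRing A] [NormedAlgebra ℂ A] [CompleteSpace A]
  [NormedCommRing B] [NormedAlgebra ℂ B] [CompleteSpace B]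
  [NormedCommRing C] [NormedAlgebra ℂ C] [CompleteSpace C]
  {ι : A ⊗[ℂ] B →ₐ[ℂ] C} {Ψ : C →ₐ[ℂ] C(characterSpace ℂ B, A)}

/-- Every character of `C` is a character of `A` composed with evaluation of `Ψ` at a point of
`M(B)`; both are obtained by restriction. -/
theorem exists_character_factorization (hι : DenseRange ι) (hΨ : Continuous Ψ)
    (hΨι : ∀ u, Ψ (ι u) = gelfandSlice A B u) (χ : characterSpace ℂ C) :
    ∃ (γ : characterSpace ℂ B) (l : characterSpace ℂ A), ∀ c, χ c = l (Ψ c γ) := by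
  let χ' : A ⊗[ℂ] B →ₐ[ℂ] ℂ := (CharacterSpace.equivAlgHom χ).comp ι
  let l : characterSpace ℂ A :=
    CharacterSpace.equivAlgHom.symm (χ'.comp Algebra.TensorProduct.includeLeft)
  let γ : characterSpace ℂ B :=
    CharacterSpace.equivAlgHom.symm (χ'.comp Algebra.TensorProduct.includeRight)
  have hχ' : χ' = (CharacterSpace.equivAlgHom l).comp
      ((ContinuousMap.evalAlgHom ℂ A γ).comp (gelfandSlice A B)) := by
    refine Algebra.TensorProduct.ext' fun a b => ?_
    change χ' (a ⊗ₜ[ℂ] b) = l (gelfandSlice A B (a ⊗ₜ[ℂ] b) γ)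
    rw [gelfandSlice_tmul, map_smul, smul_eq_mul, mul_comm]
    change _ = χ' (a ⊗ₜ[ℂ] 1) * χ' (1 ⊗ₜ[ℂ] b)
    rw [← map_mul]
    simp
  refine ⟨γ, l, fun c => ?_⟩
  refine hι.induction_on (p := fun c => χ c = l (Ψ c γ)) c ?_ fun u => ?_
  · exact isClosed_eq (map_continuous χ)
      ((map_continuous l).comp ((continuous_eval_const γ).comp hΨ))
  · rw [hΨι]
    exact DFunLike.congr_fun hχ' u

end Characters

end Tomiyama

end

open Tomiyama in
/-- A semisimple Tomiyama product `C` of `A` and `B` is, through a homomorphism `Ψ` that sends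
`a ⊗ b` to the function `γ ↦ γ(b) a`, an `A`-valued function algebra on the character space `M(B)`;
with `B` regarded as an algebra of functions on `M(B)` through its Gelfand transform,
`(M(B), A, B, C)` is a natural admissible quadruple. -/
theorem proposition1p4
    {A : Type*} [NormedCommRing A] [NormedAlgebra ℂ A] [CompleteSpace A] [Nontrivial A]
    {B : Type*} [NormedCommRing B] [NormedAlgebra ℂ B] [CompleteSpace B] [Nontrivial B]
    {C : Type*} [NormedCommRing C] [NormedAlgebra ℂ C] [CompleteSpace C]
    (ι : A ⊗[ℂ] B →ₐ[ℂ] C) (hC : Tomiyama.IsTomiyamaProduct ι)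
    (hss : Ring.jacobson C = ⊥) :
    ∃ Ψ : C →ₐ[ℂ] C(characterSpace ℂ B, A),
      (∀ (a : A) (b : B) (γ : characterSpace ℂ B), Ψ (ι (a ⊗ₜ[ℂ] b)) γ = γ b • a) ∧
      Tomiyama.IsNaturalAdmissibleQuadruple (gelfandTransform ℂ B) Ψ := by
  obtain ⟨p, hp, hιp, hι⟩ := hC
  have hle (u : A ⊗[ℂ] B) : injectiveNorm A B u ≤ ‖ι u‖ := (hp.injectiveNorm_le u).trans_eq
    (hιp u).symm
  obtain ⟨Ψ, hΨ, hΨι⟩ := exists_algHom_extension hι (gelfandSlice A B) fun u =>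
    (norm_gelfandSlice_le u).trans (hle u)
  have hΨt (a : A) (b : B) (γ : characterSpace ℂ B) : Ψ (ι (a ⊗ₜ[ℂ] b)) γ = γ b • a := by
    rw [hΨι, gelfandSlice_tmul]
  have hΨeval (γ : characterSpace ℂ B) : Continuous fun c => Ψ c γ :=
    (continuous_eval_const γ).comp hΨ
  have hΨinj : Function.Injective Ψ := by
    refine (injective_iff_map_eq_zero Ψ).2 fun c hc => ?_
    have hmem : c ∈ Ring.jacobson C := mem_jacobson_of_character_eq_zero fun χ => by
      obtain ⟨γ, l, h⟩ := exists_character_factorization hι hΨ hΨι χ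
      simp [h, hc]
    simpa [hss] using hmem
  have hGinj : Function.Injective (gelfandTransform ℂ B) := by
    refine (injective_iff_map_eq_zero _).2 fun b hb => ?_
    have hzero : ι ((1 : A) ⊗ₜ[ℂ] b) = 0 := hΨinj <| by
      ext γ
      have hγ : γ b = 0 := DFunLike.congr_fun hb γ
      simp [hΨt, hγ]
    have hnorm := hιp ((1 : A) ⊗ₜ[ℂ] b)
    rw [hzero, norm_zero, hp.cross, eq_comm, mul_eq_zero] at hnorm
    simpa using hnorm
  refine ⟨Ψ, hΨt, ⟨⟨inferInstance, ⟨⟨hGinj, ?_, ?_, ?_⟩, ?_⟩, ⟨hΨinj, ?_, ?_, hΨeval⟩, ?_, ?_⟩,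
    ?_⟩⟩
  · exact ⟨1, by rw [map_one]; rfl⟩
  · intro γ γ' hne
    by_contra! h
    exact hne (CharacterSpace.ext h)
  · exact fun γ => map_continuous γ
  · -- The evaluation of Gelfand transforms at `γ` is `γ` itself.
    have hid : evalCharacter (gelfandTransform ℂ B) = id := by
      ext γ b
      rfl
    rw [hid]
    exact Function.bijective_id
  · exact ⟨1, by rw [map_one]; rfl⟩
  · intro γ γ' hne
    by_contra! h
    refine hne (CharacterSpace.ext fun b => ?_)
    have hb := h (ι (1 ⊗ₜ[ℂ] b))
    rw [hΨt, hΨt] at hb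
    exact smul_left_injective ℂ one_ne_zero hb
  · exact fun b a => ⟨ι (a ⊗ₜ[ℂ] b), fun γ => hΨt a b γ⟩
  · intro c l
    obtain ⟨Θ, hΘ, hΘι⟩ := exists_algHom_extension hι (leftSlice B l) fun u =>
      (norm_leftSlice_le l u).trans (hle u)
    refine ⟨Θ c, fun γ => ?_⟩
    change γ (Θ c) = l (Ψ c γ)
    refine hι.induction_on (p := fun c => γ (Θ c) = l (Ψ c γ)) c ?_ fun u => ?_
    · exact isClosed_eq ((map_continuous γ).comp hΘ) ((map_continuous l).comp (hΨeval γ))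
    · rw [hΘι, hΨι]
      have heq : (CharacterSpace.equivAlgHom γ).comp (leftSlice B l) =
          (CharacterSpace.equivAlgHom l).comp
            ((ContinuousMap.evalAlgHom ℂ A γ).comp (gelfandSlice A B)) := by
        refine Algebra.TensorProduct.ext' fun a b => ?_
        change γ (leftSlice B l (a ⊗ₜ[ℂ] b)) = l (gelfandSlice A B (a ⊗ₜ[ℂ] b) γ)
        simp [mul_comm]
      exact DFunLike.congr_fun heq u
  · constructor
    · rintro ⟨γ, l⟩ ⟨γ', l'⟩ h
      have happ (c : C) : l (Ψ c γ) = l' (Ψ c γ') := DFunLike.congr_fun h c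
      -- The two components are recovered from the restrictions to `1 ⊗ b` and `a ⊗ 1`.
      refine Prod.ext (CharacterSpace.ext fun b => ?_) (CharacterSpace.ext fun a => ?_)
      · simpa [hΨt] using happ (ι (1 ⊗ₜ[ℂ] b))
      · simpa [hΨt] using happ (ι (a ⊗ₜ[ℂ] 1))
    · intro χ
      obtain ⟨γ, l, h⟩ := exists_character_factorization hι hΨ hΨι χ
      exact ⟨(γ, l), CharacterSpace.ext fun c => (h c).symm⟩
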